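/- There is an absolute constant $C>0$ such that the following holds for all dimensions $d$, all $b$ and all $\epsilon\ge 0$. Let $\mathcal{D}$ be a probability distribution of a pair $(X,Y)$ with $X\in\mathbb{R}^d$, $\|X\|_2\le b$ and $Y\in\{-1,+1\}$ almost surely. Write $\mathbb{B}_2(x,\epsilon)=\{x'\in\mathbb{R}^d:\|x'-x\|_2\le\epsilon\}$ and, for $w\in\mathbb{R}^d$, $$\mathcal{R}_{\mathrm{rob}}(w)=\mathbb{E}_{(X,Y)\sim\mathcal{D}}\,\mathbf{1}\left[\exists X'\in\mathbb{B}_2(X,\epsilon)\text{ such that }Y w^{T}X'\le 0\right].$$ Then for every $n\ge 2$ and $\delta\in(0,1)$, with probability at least $1-\delta$ over $n$ independent samples $(x_1,y_1),\dots,(x_n,y_n)\sim\mathcal{D}$, the inequality $$\mathcal{R}_{\mathrm{rob}}(w)\le\frac1n\sum_{i=1}^n\mathbf{1}\left[\exists x_i'\in\mathbb{B}_2(x_i,\epsilon)\text{ such that }y_iw^{T}x_i'\le 2\gamma\right]+\sqrt{\frac{C}{n}\left(\frac{b^2}{\gamma^2}\ln n+\ln\frac1\delta\right)}$$ holds simultaneously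 for all $\gamma>0$ and all $w\in\mathbb{R}^d$ with $\|w\|_2=1$. -/

import Mathlib

open MeasureTheory

noncomputable section

/-- The set of labelled points `(x, y)` that have some perturbation `x'` in the closed Euclidean
ball of radius `ε` around `x` at which the linear classifier `w` has margin `y * ⟪w, x'⟫ ≤ t`. -/
def robustMarginSet {d : ℕ} (ε t : ℝ) (w : EuclideanSpace ℝ (Fin d)) :
    Set (EuclideanSpace ℝ (Fin d) × ℝ) :=
  {p | ∃ x' ∈ Metric.closedBall p.1 ε, p.2 * inner ℝ w x' ≤ t}

/-- The 0-1 loss: the indicator that some `ε`-perturbation has margin at most `t`. -/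
def robustMarginLoss {d : ℕ} (ε t : ℝ) (w : EuclideanSpace ℝ (Fin d))
    (p : EuclideanSpace ℝ (Fin d) × ℝ) : ℝ :=
  (robustMarginSet ε t w).indicator (fun _ => (1 : ℝ)) p

/-- The robust error of `w` under the distribution `D` of labelled points: the expectation of the
indicator that some `ε`-perturbation has margin at most `0`. -/
def robustError {d : ℕ} (D : Measure (EuclideanSpace ℝ (Fin d) × ℝ)) (ε : ℝ)
    (w : EuclideanSpace ℝ (Fin d)) : ℝ :=
  ∫ p, robustMarginLoss ε 0 w p ∂D

/-- The fraction of the `n` sample points that have some `ε`-perturbation of margin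
at most `t`. -/
def empiricalMarginError {d n : ℕ} (S : Fin n → EuclideanSpace ℝ (Fin d) × ℝ) (ε t : ℝ)
    (w : EuclideanSpace ℝ (Fin d)) : ℝ :=
  (1 / (n : ℝ)) * ∑ i, robustMarginLoss ε t w (S i)

end

open ProbabilityTheory

set_option linter.unusedSectionVars false

/-! This is a PAC-Bayes argument with Gaussian weights. For a unit vector `w`, the worst
perturbation lowers the margin by exactly `ε`, so the robust loss is a halfspace loss with an
offset. One extra coordinate makes the halfspace homogeneous (`liftedFeature`). Let Δ be the
expected minus the empirical loss of a halfspace. For fixed weights, exp(nΔ²) has sample mean at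
most 2. Averaging over a standard Gaussian prior and applying Markov gives one event, independent of
`w` and `γ`, on which the prior mean of exp(nΔ²) is below 2/δ. Change of measure
(`integral_mul_gaussianShiftDensity_le`) and Jensen then bound the mean of Δ under every shifted
Gaussian N(m, I), at cost ‖m‖². With m a multiple of the lifted classifier, Gaussian noise rarely
moves a point across a margin of width `γ`. This turns the randomized bound into
`measureReal_inner_le_neg_margin_le`. Tails of size 1/n require ‖m‖² of order (b²/γ²) ln n. -/

/-! ### Exponential moments of squares of sub-Gaussian variables -/

lemma integral_exp_sq_div_four_gaussianReal :
    ∫ g, Real.exp (g ^ 2 / 4) ∂(gaussianReal 0 1) = √2 := by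
  have h : ∀ g : ℝ, gaussianPDFReal 0 1 g • Real.exp (g ^ 2 / 4)
      = (√(2 * Real.pi))⁻¹ * Real.exp (-(1 / 4) * g ^ 2) := by
    intro g
    simp only [gaussianPDFReal, NNReal.coe_one, mul_one, sub_zero, smul_eq_mul]
    rw [mul_assoc, ← Real.exp_add]
    ring_nf
  rw [integral_gaussianReal_eq_integral_smul one_ne_zero]
  simp_rw [h]
  rw [integral_const_mul, integral_gaussian, ← Real.sqrt_inv, ← Real.sqrt_mul (by positivity)]
  congr 1
  field_simp
  norm_num

lemma integrable_exp_sq_div_four_gaussianReal :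
    Integrable (fun g : ℝ => Real.exp (g ^ 2 / 4)) (gaussianReal 0 1) := by
  by_contra h
  have h1 := integral_exp_sq_div_four_gaussianReal
  -- A non-integrable function has integral 0 by convention, which contradicts the value √2.
  rw [integral_undef h] at h1
  have : (0 : ℝ) < √2 := by positivity
  linarith

lemma integral_exp_mul_gaussianReal (t : ℝ) :
    ∫ g, Real.exp (t * g) ∂(gaussianReal 0 1) = Real.exp (t ^ 2 / 2) := by
  have h := mgf_gaussianReal (p := gaussianReal 0 1) (X := id) (μ := 0) (v := 1)
    (by simp) t
  simpa [mgf] using h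

/-- A sub-Gaussian random variable has a bounded exponential moment of its square. -/
lemma lintegral_exp_mul_sq_le_two {Ω : Type*} [MeasurableSpace Ω] {μ : Measure Ω}
    [IsProbabilityMeasure μ] {X : Ω → ℝ} (hX : Measurable X) {c : NNReal}
    (h : HasSubgaussianMGF X c μ) {s : ℝ} (hs : 0 ≤ s) (hcs : c * s ≤ 1 / 4) :
    ∫⁻ ω, ENNReal.ofReal (Real.exp (s * X ω ^ 2)) ∂μ ≤ 2 := by
  have hsq : √(2 * s) ^ 2 = 2 * s := Real.sq_sqrt (by positivity)
  -- An auxiliary Gaussian `g` linearizes the square; after Tonelli only the moment generating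
  -- function of `X` is needed.
  have h1 : ∀ ω, ENNReal.ofReal (Real.exp (s * X ω ^ 2))
      = ∫⁻ g, ENNReal.ofReal (Real.exp (√(2 * s) * X ω * g)) ∂(gaussianReal 0 1) := by
    intro ω
    rw [← ofReal_integral_eq_lintegral_ofReal (integrable_exp_mul_gaussianReal _)
      (ae_of_all _ fun _ => (Real.exp_pos _).le), integral_exp_mul_gaussianReal, mul_pow, hsq]
    ring_nf
  simp_rw [h1]
  rw [lintegral_lintegral_swap (by fun_prop)]
  calc ∫⁻ g, ∫⁻ ω, ENNReal.ofReal (Real.exp (√(2 * s) * X ω * g)) ∂μ ∂(gaussianReal 0 1)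
      ≤ ∫⁻ g, ENNReal.ofReal (Real.exp (g ^ 2 / 4)) ∂(gaussianReal 0 1) := by
        refine lintegral_mono fun g => ?_
        have h2 : ∀ ω, √(2 * s) * X ω * g = (√(2 * s) * g) * X ω := fun ω => by ring
        simp_rw [h2]
        rw [← ofReal_integral_eq_lintegral_ofReal (h.integrable_exp_mul _)
          (ae_of_all _ fun _ => (Real.exp_pos _).le)]
        refine ENNReal.ofReal_le_ofReal ((h.mgf_le _).trans (Real.exp_le_exp.2 ?_))
        rw [mul_pow, hsq]
        nlinarith [mul_le_mul_of_nonneg_right hcs (sq_nonneg g)]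
    _ = ENNReal.ofReal (√2) := by
        rw [← ofReal_integral_eq_lintegral_ofReal integrable_exp_sq_div_four_gaussianReal
          (ae_of_all _ fun _ => (Real.exp_pos _).le), integral_exp_sq_div_four_gaussianReal]
    _ ≤ 2 := by
        rw [show (2 : ENNReal) = ENNReal.ofReal 2 by simp]
        exact ENNReal.ofReal_le_ofReal (Real.sqrt_le_left (by norm_num) |>.2 (by norm_num))

/-! ### Shifted Gaussian measures: moments and tails -/

section Gaussian

variable {V : Type*} [NormedAddCommGroup V] [InnerProductSpace ℝ V] [FiniteDimensional ℝ V]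
  [MeasurableSpace V] [BorelSpace V]

lemma map_inner_stdGaussian (u : V) :
    (stdGaussian V).map (fun v => inner ℝ u v) = gaussianReal 0 (‖u‖ ^ 2).toNNReal := by
  have h := IsGaussian.map_eq_gaussianReal (μ := stdGaussian V) (innerSL ℝ u)
  rw [integral_strongDual_stdGaussian, variance_dual_stdGaussian] at h
  simpa using h

lemma integrable_exp_inner_stdGaussian (u : V) :
    Integrable (fun v => Real.exp (inner ℝ u v)) (stdGaussian V) := by
  have h := integrable_exp_mul_gaussianReal (μ := 0) (v := (‖u‖ ^ 2).toNNReal) 1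
  rw [← map_inner_stdGaussian, integrable_map_measure (by fun_prop) (by fun_prop)] at h
  simpa [Function.comp_def] using h

lemma integral_exp_inner_stdGaussian (u : V) :
    ∫ v, Real.exp (inner ℝ u v) ∂(stdGaussian V) = Real.exp (‖u‖ ^ 2 / 2) := by
  have h := mgf_gaussianReal (map_inner_stdGaussian u) 1
  simpa [mgf] using h

/-- The density of the Gaussian with mean `m` and identity covariance with respect to the standard
Gaussian. -/
noncomputable def gaussianShiftDensity (m v : V) : ℝ := Real.exp (inner ℝ m v - ‖m‖ ^ 2 / 2)

lemma gaussianShiftDensity_pos (m v : V) : 0 < gaussianShiftDensity m v := Real.exp_pos _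

/-- Merging exponents reduces every moment under the shifted law to the moment generating function
of the standard Gaussian. -/
lemma exp_inner_mul_gaussianShiftDensity (m u v : V) :
    Real.exp (inner ℝ u v) * gaussianShiftDensity m v
      = Real.exp (-(‖m‖ ^ 2 / 2)) * Real.exp (inner ℝ (u + m) v) := by
  rw [gaussianShiftDensity, ← Real.exp_add, ← Real.exp_add, inner_add_left]
  ring_nf

lemma integrable_exp_inner_mul_gaussianShiftDensity (m u : V) :
    Integrable (fun v => Real.exp (inner ℝ u v) * gaussianShiftDensity m v) (stdGaussian V) := by
  simp_rw [exp_inner_mul_gaussianShiftDensity]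
  exact (integrable_exp_inner_stdGaussian _).const_mul _

lemma integral_exp_inner_mul_gaussianShiftDensity (m u : V) :
    ∫ v, Real.exp (inner ℝ u v) * gaussianShiftDensity m v ∂(stdGaussian V)
      = Real.exp (‖u‖ ^ 2 / 2 + inner ℝ u m) := by
  simp_rw [exp_inner_mul_gaussianShiftDensity]
  rw [integral_const_mul, integral_exp_inner_stdGaussian, ← Real.exp_add, norm_add_sq_real]
  ring_nf

lemma integrable_gaussianShiftDensity (m : V) :
    Integrable (gaussianShiftDensity m) (stdGaussian V) := by
  simpa using integrable_exp_inner_mul_gaussianShiftDensity m 0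

lemma integral_gaussianShiftDensity (m : V) :
    ∫ v, gaussianShiftDensity m v ∂(stdGaussian V) = 1 := by
  simpa using integral_exp_inner_mul_gaussianShiftDensity m 0

lemma gaussianShiftDensity_sq (m v : V) :
    gaussianShiftDensity m v ^ 2 = Real.exp (inner ℝ m v) * gaussianShiftDensity m v
      * Real.exp (-(‖m‖ ^ 2 / 2)) := by
  rw [gaussianShiftDensity, ← Real.exp_add, ← Real.exp_add, ← Real.exp_nat_mul]
  push_cast
  ring_nf

lemma integrable_gaussianShiftDensity_sq (m : V) :
    Integrable (fun v => gaussianShiftDensity m v ^ 2) (stdGaussian V) := by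
  simp_rw [gaussianShiftDensity_sq]
  exact (integrable_exp_inner_mul_gaussianShiftDensity m m).mul_const _

/-- This is one plus the chi-square divergence of the shifted law from the standard one; it plays
the role of relative entropy in the change of measure. -/
lemma integral_gaussianShiftDensity_sq (m : V) :
    ∫ v, gaussianShiftDensity m v ^ 2 ∂(stdGaussian V) = Real.exp (‖m‖ ^ 2) := by
  simp_rw [gaussianShiftDensity_sq]
  rw [integral_mul_const, integral_exp_inner_mul_gaussianShiftDensity, ← Real.exp_add,
    real_inner_self_eq_norm_sq]
  ring_nf

/-- Tail bound for linear functionals of a Gaussian with mean `m`. -/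
lemma integral_indicator_inner_mul_gaussianShiftDensity_le (m z : V) {B t : ℝ} (hB : 0 < B)
    (hz : ‖z‖ ≤ B) (ht : 0 ≤ t) :
    ∫ v, {v | inner ℝ z m + t ≤ inner ℝ z v}.indicator 1 v * gaussianShiftDensity m v
      ∂(stdGaussian V) ≤ Real.exp (-(t ^ 2 / (2 * B ^ 2))) := by
  -- The Chernoff parameter, minimizing l²B²/2 - lt.
  set l : ℝ := t / B ^ 2 with hl
  have hl0 : 0 ≤ l := by positivity
  have key : ∀ v, {v | inner ℝ z m + t ≤ inner ℝ z v}.indicator (1 : V → ℝ) v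
      * gaussianShiftDensity m v ≤ Real.exp (-(l * (inner ℝ z m + t)))
        * (Real.exp (inner ℝ (l • z) v) * gaussianShiftDensity m v) := by
    intro v
    rw [← mul_assoc, ← Real.exp_add, real_inner_smul_left]
    refine mul_le_mul_of_nonneg_right ?_ (gaussianShiftDensity_pos m v).le
    by_cases hv : inner ℝ z m + t ≤ inner ℝ z v
    · rw [Set.indicator_of_mem (by exact hv)]
      exact Real.one_le_exp (by nlinarith)
    · rw [Set.indicator_of_notMem (by exact hv)]
      exact (Real.exp_pos _).le
  calc _ ≤ ∫ v, Real.exp (-(l * (inner ℝ z m + t)))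
        * (Real.exp (inner ℝ (l • z) v) * gaussianShiftDensity m v) ∂(stdGaussian V) := by
        refine integral_mono_of_nonneg (ae_of_all _ fun v => ?_)
          ((integrable_exp_inner_mul_gaussianShiftDensity m _).const_mul _) (ae_of_all _ key)
        exact mul_nonneg (Set.indicator_nonneg (fun _ _ => zero_le_one) _)
          (gaussianShiftDensity_pos m v).le
    _ ≤ _ := by
        rw [integral_const_mul, integral_exp_inner_mul_gaussianShiftDensity, ← Real.exp_add,
          Real.exp_le_exp, norm_smul, real_inner_smul_left, mul_pow, Real.norm_eq_abs, sq_abs]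
        have h1 : ‖z‖ ^ 2 ≤ B ^ 2 := by gcongr
        have h2 : l ^ 2 * ‖z‖ ^ 2 ≤ l ^ 2 * B ^ 2 := by gcongr
        have h3 : l ^ 2 * B ^ 2 = t ^ 2 / B ^ 2 := by rw [hl]; field_simp
        have h4 : l * t = t ^ 2 / B ^ 2 := by rw [hl]; ring
        have h5 : t ^ 2 / (2 * B ^ 2) = t ^ 2 / B ^ 2 / 2 := by field_simp
        rw [h5]
        nlinarith

end Gaussian

/-! ### Change of measure and Gaussian smoothing of halfspace losses -/

section Halfspace

variable {V : Type*} [NormedAddCommGroup V] [InnerProductSpace ℝ V] [FiniteDimensional ℝ V]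
  [MeasurableSpace V] [BorelSpace V]

/-- A bounded function integrates under a shifted Gaussian to at most the logarithm of its
exponential moment under the standard Gaussian plus a divergence term. -/
lemma integral_mul_gaussianShiftDensity_le {φ : V → ℝ} (hφ : Measurable φ) {M : ℝ}
    (hφM : ∀ v, |φ v| ≤ M) (m : V) {f : ℝ}
    (hf : ∫ v, Real.exp (φ v) ∂(stdGaussian V) ≤ Real.exp f) :
    ∫ v, φ v * gaussianShiftDensity m v ∂(stdGaussian V) ≤ f + ‖m‖ ^ 2 := by
  have hexp : Integrable (fun v => Real.exp (φ v)) (stdGaussian V) := by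
    refine Integrable.of_bound (by fun_prop) (Real.exp M) (ae_of_all _ fun v => ?_)
    rw [Real.norm_eq_abs, Real.abs_exp]
    exact Real.exp_le_exp.2 ((le_abs_self _).trans (hφM v))
  -- Write r for the density. Apply x + 1 ≤ exp x at x = (φ - f - ‖m‖²)/2, multiply by 2r, and split
  -- the product by 2ab ≤ a² + b². Each of the last two terms has integral at most 1, cancelling the
  -- -2.
  have key : ∀ v, φ v * gaussianShiftDensity m v ≤ (f + ‖m‖ ^ 2 - 2) * gaussianShiftDensity m v
      + (Real.exp (-f) * Real.exp (φ v)
        + Real.exp (-‖m‖ ^ 2) * gaussianShiftDensity m v ^ 2) := by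
    intro v
    have hr := gaussianShiftDensity_pos m v
    set r := gaussianShiftDensity m v
    have h1 := Real.add_one_le_exp ((φ v - f) / 2 + (-‖m‖ ^ 2) / 2)
    have h2 := mul_le_mul_of_nonneg_right h1 hr.le
    rw [Real.exp_add] at h2
    have h3 : Real.exp ((φ v - f) / 2) ^ 2 = Real.exp (-f) * Real.exp (φ v) := by
      rw [← Real.exp_nat_mul, ← Real.exp_add]; push_cast; ring_nf
    have h4 : Real.exp ((-‖m‖ ^ 2) / 2) ^ 2 = Real.exp (-‖m‖ ^ 2) := by
      rw [← Real.exp_nat_mul]; push_cast; ring_nf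
    rw [← h3, ← h4]
    nlinarith [sq_nonneg (Real.exp ((φ v - f) / 2) - Real.exp ((-‖m‖ ^ 2) / 2) * r)]
  have hr := integrable_gaussianShiftDensity m
  have hr2 := integrable_gaussianShiftDensity_sq m
  have hφr : Integrable (fun v => φ v * gaussianShiftDensity m v) (stdGaussian V) :=
    hr.bdd_mul (c := M) (by fun_prop) (ae_of_all _ hφM)
  have h5 := integral_mono hφr ((hr.const_mul _).add
    ((hexp.const_mul _).add (hr2.const_mul _))) key
  refine h5.trans ?_
  rw [integral_add' (hr.const_mul _) ((hexp.const_mul _).add (hr2.const_mul _)),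
    integral_add' (hexp.const_mul _) (hr2.const_mul _), integral_const_mul, integral_const_mul,
    integral_const_mul, integral_gaussianShiftDensity,
    integral_gaussianShiftDensity_sq, ← Real.exp_add]
  have h6 : Real.exp (-f) * ∫ v, Real.exp (φ v) ∂(stdGaussian V) ≤ 1 := by
    calc _ ≤ Real.exp (-f) * Real.exp f := by gcongr
      _ = 1 := by rw [← Real.exp_add]; simp
  simp only [neg_add_cancel, Real.exp_zero]
  linarith

/-- The 0-1 loss of the homogeneous linear classifier `u` at the point `z`. -/
noncomputable def halfspaceLoss (u z : V) : ℝ :=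
  {p : V × V | inner ℝ p.1 p.2 ≤ 0}.indicator 1 (u, z)

lemma halfspaceLoss_of_nonpos {u z : V} (h : inner ℝ u z ≤ 0) : halfspaceLoss u z = 1 :=
  Set.indicator_of_mem (s := {p : V × V | inner ℝ p.1 p.2 ≤ 0}) (a := (u, z)) h 1

lemma halfspaceLoss_of_pos {u z : V} (h : 0 < inner ℝ u z) : halfspaceLoss u z = 0 :=
  Set.indicator_of_notMem (s := {p : V × V | inner ℝ p.1 p.2 ≤ 0}) (a := (u, z))
    (not_le.2 h) 1

lemma halfspaceLoss_mem_Icc (u z : V) : halfspaceLoss u z ∈ Set.Icc (0 : ℝ) 1 := by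
  rcases le_or_gt (inner ℝ u z) 0 with h | h
  · simp [halfspaceLoss_of_nonpos h]
  · simp [halfspaceLoss_of_pos h]

lemma abs_halfspaceLoss_le_one (u z : V) : |halfspaceLoss u z| ≤ 1 := by
  rw [abs_of_nonneg (halfspaceLoss_mem_Icc u z).1]
  exact (halfspaceLoss_mem_Icc u z).2

@[fun_prop]
lemma measurable_halfspaceLoss {α : Type*} [MeasurableSpace α] {f g : α → V} (hf : Measurable f)
    (hg : Measurable g) : Measurable (fun a => halfspaceLoss (f a) (g a)) := by
  have h : Measurable ({p : V × V | inner ℝ p.1 p.2 ≤ 0}.indicator (1 : V × V → ℝ)) :=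
    measurable_one.indicator (measurableSet_le (by fun_prop) measurable_const)
  exact h.comp (hf.prodMk hg)

lemma integrable_halfspaceLoss_mul_gaussianShiftDensity (m z : V) :
    Integrable (fun v => halfspaceLoss v z * gaussianShiftDensity m v) (stdGaussian V) :=
  (integrable_gaussianShiftDensity m).bdd_mul (c := 1) (by fun_prop)
    (ae_of_all _ fun v => abs_halfspaceLoss_le_one v z)

lemma integrable_indicator_inner_mul_gaussianShiftDensity (m z : V) (t : ℝ) :
    Integrable (fun v => {v | t ≤ inner ℝ z v}.indicator 1 v * gaussianShiftDensity m v)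
      (stdGaussian V) := by
  have hm : Measurable ({v | t ≤ inner ℝ z v}.indicator (1 : V → ℝ)) :=
    measurable_one.indicator (measurableSet_le measurable_const (by fun_prop))
  refine (integrable_gaussianShiftDensity m).bdd_mul (c := 1) hm.aestronglyMeasurable
    (ae_of_all _ fun v => ?_)
  by_cases h : v ∈ {v | t ≤ inner ℝ z v} <;> simp [h]

/-- A point misclassified by `w` with margin `γ` is misclassified by most Gaussian perturbations
of `s • w`. -/
lemma indicator_le_integral_halfspaceLoss_add (w z : V) {B γ s : ℝ} (hB : 0 < B) (hz : ‖z‖ ≤ B)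
    (hγ : 0 ≤ γ) (hs : 0 ≤ s) :
    {z | inner ℝ w z ≤ -γ}.indicator 1 z
      ≤ ∫ v, halfspaceLoss v z * gaussianShiftDensity (s • w) v ∂(stdGaussian V)
        + Real.exp (-((s * γ) ^ 2 / (2 * B ^ 2))) := by
  have hnn : 0 ≤ ∫ v, halfspaceLoss v z * gaussianShiftDensity (s • w) v ∂(stdGaussian V) :=
    integral_nonneg fun v => mul_nonneg (halfspaceLoss_mem_Icc v z).1
      (gaussianShiftDensity_pos _ v).le
  by_cases h : inner ℝ w z ≤ -γ
  · rw [Set.indicator_of_mem (by exact h)]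
    -- Either `v` misclassifies `z`, or the noise raises the inner product with `z` by at least `s *
    -- γ`; so the loss plus the tail indicator is at least 1.
    have h1 := integral_indicator_inner_mul_gaussianShiftDensity_le (s • w) z hB hz
      (mul_nonneg hs hγ)
    refine le_trans ?_ (add_le_add_right h1 _)
    rw [← integral_add (integrable_halfspaceLoss_mul_gaussianShiftDensity _ _)
      (integrable_indicator_inner_mul_gaussianShiftDensity _ _ _), Pi.one_apply,
      ← integral_gaussianShiftDensity (s • w)]
    refine integral_mono (integrable_gaussianShiftDensity _)
      ((integrable_halfspaceLoss_mul_gaussianShiftDensity _ _).add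
      (integrable_indicator_inner_mul_gaussianShiftDensity _ _ _)) fun v => ?_
    simp only
    have hr := gaussianShiftDensity_pos (s • w) v
    rcases le_or_gt (inner ℝ v z) 0 with hv | hv
    · rw [halfspaceLoss_of_nonpos hv]
      have := Set.indicator_nonneg (s := {v | inner ℝ z (s • w) + s * γ ≤ inner ℝ z v})
        (f := (1 : V → ℝ)) (fun _ _ => zero_le_one) v
      nlinarith
    · rw [Set.indicator_of_mem]
      · simp [halfspaceLoss_of_pos hv]
      · change inner ℝ z (s • w) + s * γ ≤ inner ℝ z v
        rw [real_inner_smul_right, real_inner_comm w z, real_inner_comm v z]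
        nlinarith
  · rw [Set.indicator_of_notMem (by exact h)]
    positivity

/-- A point misclassified by many Gaussian perturbations of `s • w` has margin at most `γ`. -/
lemma integral_halfspaceLoss_le_indicator_add (w z : V) {B γ s : ℝ} (hB : 0 < B) (hz : ‖z‖ ≤ B)
    (hγ : 0 ≤ γ) (hs : 0 ≤ s) :
    ∫ v, halfspaceLoss v z * gaussianShiftDensity (s • w) v ∂(stdGaussian V)
      ≤ {z | inner ℝ w z ≤ γ}.indicator 1 z
        + Real.exp (-((s * γ) ^ 2 / (2 * B ^ 2))) := by
  by_cases h : inner ℝ w z ≤ γ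
  · rw [Set.indicator_of_mem (by exact h)]
    have h1 : ∫ v, halfspaceLoss v z * gaussianShiftDensity (s • w) v ∂(stdGaussian V) ≤ 1 := by
      rw [← integral_gaussianShiftDensity (s • w)]
      refine integral_mono (integrable_halfspaceLoss_mul_gaussianShiftDensity _ _)
        (integrable_gaussianShiftDensity _) fun v => ?_
      have hr := gaussianShiftDensity_pos (s • w) v
      have := (halfspaceLoss_mem_Icc v z).2
      simp only
      nlinarith
    exact h1.trans (le_add_of_nonneg_right (Real.exp_pos _).le)
  · rw [Set.indicator_of_notMem (by exact h), zero_add]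
    have h1 := integral_indicator_inner_mul_gaussianShiftDensity_le (s • w) (-z) hB
      (by rwa [norm_neg]) (mul_nonneg hs hγ)
    refine le_trans (integral_mono (integrable_halfspaceLoss_mul_gaussianShiftDensity _ _)
      (integrable_indicator_inner_mul_gaussianShiftDensity _ _ _) fun v => ?_) h1
    simp only
    refine mul_le_mul_of_nonneg_right ?_ (gaussianShiftDensity_pos (s • w) v).le
    rcases le_or_gt (inner ℝ v z) 0 with hv | hv
    · rw [Set.indicator_of_mem]
      · exact (halfspaceLoss_mem_Icc v z).2
      · change inner ℝ (-z) (s • w) + s * γ ≤ inner ℝ (-z) v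
        rw [inner_neg_left, inner_neg_left, real_inner_smul_right, real_inner_comm w z,
          real_inner_comm v z]
        nlinarith
    · rw [halfspaceLoss_of_pos hv]
      exact Set.indicator_nonneg (fun _ _ => zero_le_one) _

/-! ### Generalization gap of randomized halfspaces -/

variable {Ω : Type*} [MeasurableSpace Ω] {D : Measure Ω} [IsProbabilityMeasure D] {Z : Ω → V}
  {n : ℕ}

/-- The difference between the expected and the empirical 0-1 loss of the halfspace `v`. -/
noncomputable def halfspaceDeviation (D : Measure Ω) (Z : Ω → V) (S : Fin n → Ω) (v : V) : ℝ :=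
  ∫ ω, halfspaceLoss v (Z ω) ∂D - (1 / (n : ℝ)) * ∑ i, halfspaceLoss v (Z (S i))

lemma measurable_integral_halfspaceLoss (hZ : Measurable Z) :
    Measurable (fun v => ∫ ω, halfspaceLoss v (Z ω) ∂D) := by
  have h : StronglyMeasurable (Function.uncurry fun v ω => halfspaceLoss v (Z ω)) :=
    Measurable.stronglyMeasurable (by unfold Function.uncurry; fun_prop)
  exact h.integral_prod_right.measurable

lemma measurable_halfspaceDeviation (hZ : Measurable Z) :
    Measurable (fun p : (Fin n → Ω) × V => halfspaceDeviation D Z p.1 p.2) := by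
  unfold halfspaceDeviation
  have h := (measurable_integral_halfspaceLoss (D := D) hZ).comp
    (measurable_snd : Measurable (Prod.snd : (Fin n → Ω) × V → V))
  refine h.sub (measurable_const.mul (Finset.measurable_sum _ fun i _ => ?_))
  exact measurable_halfspaceLoss measurable_snd
    (hZ.comp ((measurable_pi_apply i).comp measurable_fst))

lemma integrable_halfspaceLoss (hZ : Measurable Z) (v : V) :
    Integrable (fun ω => halfspaceLoss v (Z ω)) D :=
  Integrable.of_bound (measurable_halfspaceLoss measurable_const hZ).aestronglyMeasurable 1
    (ae_of_all _ fun ω => abs_halfspaceLoss_le_one v (Z ω))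

lemma abs_halfspaceDeviation_le_one (hZ : Measurable Z) (S : Fin n → Ω) (v : V) :
    |halfspaceDeviation D Z S v| ≤ 1 := by
  have h1 : 0 ≤ ∫ ω, halfspaceLoss v (Z ω) ∂D :=
    integral_nonneg fun ω => (halfspaceLoss_mem_Icc v (Z ω)).1
  have h2 : ∫ ω, halfspaceLoss v (Z ω) ∂D ≤ 1 := by
    calc _ ≤ ∫ _, (1 : ℝ) ∂D := integral_mono (integrable_halfspaceLoss hZ v)
          (integrable_const _) fun ω => (halfspaceLoss_mem_Icc v (Z ω)).2
      _ = 1 := by simp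
  have h3 : 0 ≤ (1 / (n : ℝ)) * ∑ i, halfspaceLoss v (Z (S i)) :=
    mul_nonneg (by positivity) (Finset.sum_nonneg fun i _ => (halfspaceLoss_mem_Icc v _).1)
  have h4 : (1 / (n : ℝ)) * ∑ i, halfspaceLoss v (Z (S i)) ≤ 1 := by
    have h5 : ∑ i, halfspaceLoss v (Z (S i)) ≤ n := by
      calc _ ≤ ∑ _i : Fin n, (1 : ℝ) :=
            Finset.sum_le_sum fun i _ => (halfspaceLoss_mem_Icc v _).2
        _ = n := by simp
    rw [one_div, inv_mul_eq_div]
    exact div_le_one_of_le₀ h5 (by positivity)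
  rw [halfspaceDeviation, abs_le]
  constructor <;> linarith

/-- By Hoeffding each centred loss has sub-Gaussian parameter 1/4, so their sum has n/4, and the
scale 1/n exactly meets the condition `c * s ≤ 1 / 4`. -/
lemma lintegral_exp_halfspaceDeviation_sq_le_two (hZ : Measurable Z) (hn : 0 < n) (v : V) :
    ∫⁻ S, ENNReal.ofReal (Real.exp (n * halfspaceDeviation D Z S v ^ 2))
      ∂(Measure.pi fun _ : Fin n => D) ≤ 2 := by
  have hn' : (0 : ℝ) < n := by exact_mod_cast hn
  set Y : Ω → ℝ := fun ω => halfspaceLoss v (Z ω) - ∫ ω, halfspaceLoss v (Z ω) ∂D with hY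
  have hYm : Measurable Y := by fun_prop
  have hsub : HasSubgaussianMGF Y ((‖(1 : ℝ) - 0‖₊ / 2) ^ 2) D :=
    hasSubgaussianMGF_of_mem_Icc (by fun_prop) (ae_of_all _ fun ω => halfspaceLoss_mem_Icc v (Z ω))
  have hind : iIndepFun (fun (i : Fin n) (S : Fin n → Ω) => Y (S i))
      (Measure.pi fun _ : Fin n => D) := iIndepFun_pi fun _ => hYm.aemeasurable
  have hsum := HasSubgaussianMGF.sum_of_iIndepFun hind
    (c := fun _ => (‖(1 : ℝ) - 0‖₊ / 2) ^ 2) (s := Finset.univ) fun i _ =>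
      HasSubgaussianMGF.of_map (μ := Measure.pi fun _ : Fin n => D) (X := Y) (Y := fun S => S i)
        (measurable_pi_apply i).aemeasurable
        (by rw [(measurePreserving_eval (fun _ : Fin n => D) i).map_eq]; exact hsub)
  have h := lintegral_exp_mul_sq_le_two (s := 1 / n) (by fun_prop) hsum (by positivity) (by
    simp
    field_simp
    norm_num)
  refine le_trans (le_of_eq (lintegral_congr fun S => ?_)) h
  congr 2
  have h2 : ∑ i, Y (S i) = -(n * halfspaceDeviation D Z S v) := by
    simp only [hY, halfspaceDeviation, Finset.sum_sub_distrib, Finset.sum_const, Finset.card_univ,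
      Fintype.card_fin, nsmul_eq_mul]
    field_simp
    ring
  rw [h2]
  field_simp

/-- Tonelli and Markov. The event involves only the prior, which makes the final bound simultaneous
in `w` and `γ`. -/
lemma measure_le_lintegral_exp_halfspaceDeviation_sq_le (hZ : Measurable Z) (hn : 0 < n) {δ : ℝ}
    (hδ : 0 < δ) :
    (Measure.pi fun _ : Fin n => D) {S | ENNReal.ofReal (2 / δ) ≤
      ∫⁻ v, ENNReal.ofReal (Real.exp (n * halfspaceDeviation D Z S v ^ 2)) ∂(stdGaussian V)}
      ≤ ENNReal.ofReal δ := by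
  have hm : Measurable (Function.uncurry fun (S : Fin n → Ω) (v : V) =>
      ENNReal.ofReal (Real.exp (n * halfspaceDeviation D Z S v ^ 2))) :=
    (Real.measurable_exp.comp
      (((measurable_halfspaceDeviation hZ).pow_const 2).const_mul _)).ennreal_ofReal
  have h := meas_ge_le_lintegral_div (μ := Measure.pi fun _ : Fin n => D)
    (hm.lintegral_prod_right' (ν := stdGaussian V)).aemeasurable
    (ε := ENNReal.ofReal (2 / δ)) (by simpa using hδ) ENNReal.ofReal_ne_top
  refine h.trans ?_
  refine (ENNReal.div_le_div_right (b := 2) ?_ _).trans ?_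
  · have := lintegral_lintegral_swap (μ := Measure.pi fun _ : Fin n => D) (ν := stdGaussian V)
      hm.aemeasurable
    simp only [Function.uncurry] at this ⊢
    rw [this]
    calc _ ≤ ∫⁻ _, 2 ∂(stdGaussian V) :=
          lintegral_mono fun v => lintegral_exp_halfspaceDeviation_sq_le_two hZ hn v
      _ = 2 := by simp
  · rw [show (2 : ENNReal) = ENNReal.ofReal 2 by simp, ← ENNReal.ofReal_div_of_pos (by positivity)]
    apply le_of_eq
    congr 1
    field_simp

lemma integral_halfspaceDeviation_mul_le (hZ : Measurable Z) (hn : 0 < n) {S : Fin n → Ω}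
    {f : ℝ} (hS : ∫⁻ v, ENNReal.ofReal (Real.exp (n * halfspaceDeviation D Z S v ^ 2))
      ∂(stdGaussian V) ≤ ENNReal.ofReal (Real.exp f)) (m : V) :
    ∫ v, halfspaceDeviation D Z S v * gaussianShiftDensity m v ∂(stdGaussian V)
      ≤ √((f + ‖m‖ ^ 2) / n) := by
  have hn' : (0 : ℝ) < n := by exact_mod_cast hn
  have hΔ : Measurable (fun v => halfspaceDeviation D Z S v) :=
    (measurable_halfspaceDeviation hZ).comp measurable_prodMk_left
  have hΔ1 := abs_halfspaceDeviation_le_one (D := D) hZ S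
  have hsq1 : ∀ v, halfspaceDeviation D Z S v ^ 2 ≤ 1 := fun v => by
    rw [← sq_abs]; exact pow_le_one₀ (abs_nonneg _) (hΔ1 v)
  have hb : ∀ v, |n * halfspaceDeviation D Z S v ^ 2| ≤ n := fun v => by
    rw [abs_of_nonneg (by positivity)]
    nlinarith [hsq1 v]
  have hexp : Integrable (fun v => Real.exp (n * halfspaceDeviation D Z S v ^ 2))
      (stdGaussian V) := by
    refine Integrable.of_bound (by fun_prop) (Real.exp n) (ae_of_all _ fun v => ?_)
    rw [Real.norm_eq_abs, Real.abs_exp]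
    exact Real.exp_le_exp.2 ((le_abs_self _).trans (hb v))
  rw [← ofReal_integral_eq_lintegral_ofReal hexp (ae_of_all _ fun _ => (Real.exp_pos _).le),
    ENNReal.ofReal_le_ofReal_iff (Real.exp_pos _).le] at hS
  have h1 := integral_mul_gaussianShiftDensity_le (hΔ.pow_const 2 |>.const_mul _) hb m hS
  have hr := integrable_gaussianShiftDensity m
  have i1 : Integrable (fun v => halfspaceDeviation D Z S v * gaussianShiftDensity m v)
      (stdGaussian V) := hr.bdd_mul (c := 1) (by fun_prop) (ae_of_all _ hΔ1)
  have i2 : Integrable (fun v => n * halfspaceDeviation D Z S v ^ 2 * gaussianShiftDensity m v)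
      (stdGaussian V) := hr.bdd_mul (c := n) (by fun_prop) (ae_of_all _ hb)
  set c := ∫ v, halfspaceDeviation D Z S v * gaussianShiftDensity m v ∂(stdGaussian V) with hc
  have h2 : n * c ^ 2 ≤ ∫ v, n * halfspaceDeviation D Z S v ^ 2 * gaussianShiftDensity m v
      ∂(stdGaussian V) := by
    -- Jensen for the square: Δ² ≥ 2cΔ - c² pointwise, integrated against the shifted density.
    have h3 : ∫ v, (2 * n * c * (halfspaceDeviation D Z S v * gaussianShiftDensity m v)
        - n * c ^ 2 * gaussianShiftDensity m v) ∂(stdGaussian V) = n * c ^ 2 := by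
      rw [integral_sub (i1.const_mul _) (hr.const_mul _), integral_const_mul, integral_const_mul,
        integral_gaussianShiftDensity, ← hc]
      ring
    rw [← h3]
    refine integral_mono ((i1.const_mul _).sub (hr.const_mul _)) i2 fun v => ?_
    have h4 : 0 ≤ n * gaussianShiftDensity m v * (halfspaceDeviation D Z S v - c) ^ 2 := by
      have := gaussianShiftDensity_pos m v
      positivity
    simp only
    nlinarith
  refine Real.le_sqrt_of_sq_le ?_
  rw [le_div_iff₀ hn']
  linarith

/-- The empirical margin bound for halfspaces, with noise level `1 / s`. -/
lemma measureReal_inner_le_neg_margin_le (hZ : Measurable Z) (hn : 0 < n) {B : ℝ} (hB : 0 < B)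
    (hZB : ∀ᵐ ω ∂D, ‖Z ω‖ ≤ B) {S : Fin n → Ω} (hSB : ∀ i, ‖Z (S i)‖ ≤ B)
    {f : ℝ} (hS : ∫⁻ v, ENNReal.ofReal (Real.exp (n * halfspaceDeviation D Z S v ^ 2))
      ∂(stdGaussian V) ≤ ENNReal.ofReal (Real.exp f)) (w : V) {γ s : ℝ} (hγ : 0 ≤ γ)
    (hs : 0 ≤ s) :
    ∫ ω, {z | inner ℝ w z ≤ -γ}.indicator 1 (Z ω) ∂D
      ≤ (1 / (n : ℝ)) * ∑ i, {z | inner ℝ w z ≤ γ}.indicator 1 (Z (S i))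
        + 2 * Real.exp (-((s * γ) ^ 2 / (2 * B ^ 2))) + √((f + (s * ‖w‖) ^ 2) / n) := by
  have hn' : (0 : ℝ) < n := by exact_mod_cast hn
  set η := Real.exp (-((s * γ) ^ 2 / (2 * B ^ 2)))
  set m := s • w with hm
  have hnorm : ‖m‖ ^ 2 = (s * ‖w‖) ^ 2 := by
    rw [hm, norm_smul, mul_pow, mul_pow, Real.norm_eq_abs, sq_abs]
  have hr := integrable_gaussianShiftDensity m
  have hprod : Integrable (Function.uncurry fun ω v =>
      halfspaceLoss v (Z ω) * gaussianShiftDensity m v) (D.prod (stdGaussian V)) := by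
    refine (hr.comp_snd D).bdd_mul (c := 1) ?_ (ae_of_all _ fun p => ?_)
    · exact (measurable_halfspaceLoss measurable_snd (hZ.comp measurable_fst)).aestronglyMeasurable
    · exact abs_halfspaceLoss_le_one p.2 (Z p.1)
  have hswap : ∫ ω, ∫ v, halfspaceLoss v (Z ω) * gaussianShiftDensity m v ∂(stdGaussian V) ∂D
      = ∫ v, (∫ ω, halfspaceLoss v (Z ω) ∂D) * gaussianShiftDensity m v ∂(stdGaussian V) := by
    rw [integral_integral_swap hprod]
    simp_rw [integral_mul_const]
  have hleft : ∫ ω, {z | inner ℝ w z ≤ -γ}.indicator 1 (Z ω) ∂D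
      ≤ ∫ v, (∫ ω, halfspaceLoss v (Z ω) ∂D) * gaussianShiftDensity m v ∂(stdGaussian V) + η := by
    rw [← hswap]
    have h1 : ∫ ω, (∫ v, halfspaceLoss v (Z ω) * gaussianShiftDensity m v ∂(stdGaussian V) + η) ∂D
        = ∫ ω, ∫ v, halfspaceLoss v (Z ω) * gaussianShiftDensity m v ∂(stdGaussian V) ∂D + η := by
      have h2 := integral_add hprod.integral_prod_left (integrable_const (μ := D) η)
      simpa [Function.uncurry] using h2
    rw [← h1]
    refine integral_mono_of_nonneg
      (ae_of_all _ fun ω => Set.indicator_nonneg (fun _ _ => zero_le_one) _)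
      (hprod.integral_prod_left.add (integrable_const _)) ?_
    filter_upwards [hZB] with ω hω
    exact indicator_le_integral_halfspaceLoss_add w (Z ω) hB hω hγ hs
  have hright : (1 / (n : ℝ)) * ∑ i, ∫ v, halfspaceLoss v (Z (S i)) * gaussianShiftDensity m v
      ∂(stdGaussian V) ≤ (1 / (n : ℝ)) * ∑ i, {z | inner ℝ w z ≤ γ}.indicator 1 (Z (S i)) + η := by
    have h1 : η = (1 / (n : ℝ)) * ∑ _i : Fin n, η := by
      simp
      field_simp
    rw [h1, ← mul_add, ← Finset.sum_add_distrib]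
    refine mul_le_mul_of_nonneg_left (Finset.sum_le_sum fun i _ => ?_) (by positivity)
    exact integral_halfspaceLoss_le_indicator_add w (Z (S i)) hB (hSB i) hγ hs
  have hdev := integral_halfspaceDeviation_mul_le hZ hn hS m
  have heq : ∫ v, halfspaceDeviation D Z S v * gaussianShiftDensity m v ∂(stdGaussian V)
      = ∫ v, (∫ ω, halfspaceLoss v (Z ω) ∂D) * gaussianShiftDensity m v ∂(stdGaussian V)
        - (1 / (n : ℝ)) * ∑ i, ∫ v, halfspaceLoss v (Z (S i)) * gaussianShiftDensity m v
          ∂(stdGaussian V) := by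
    have h1 : ∀ v, halfspaceDeviation D Z S v * gaussianShiftDensity m v
        = (∫ ω, halfspaceLoss v (Z ω) ∂D) * gaussianShiftDensity m v
          - (1 / (n : ℝ)) * ∑ i, halfspaceLoss v (Z (S i)) * gaussianShiftDensity m v := fun v => by
      rw [halfspaceDeviation, sub_mul, mul_assoc, Finset.sum_mul]
    simp_rw [h1]
    have h2 : Integrable (fun v => (∫ ω, halfspaceLoss v (Z ω) ∂D) * gaussianShiftDensity m v)
        (stdGaussian V) := by
      simpa only [Function.uncurry, integral_mul_const] using hprod.integral_prod_right
    rw [integral_sub h2 ((integrable_finsetSum _ fun i _ =>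
      integrable_halfspaceLoss_mul_gaussianShiftDensity m (Z (S i))).const_mul _),
      integral_const_mul, integral_finsetSum _ fun i _ =>
      integrable_halfspaceLoss_mul_gaussianShiftDensity m (Z (S i))]
  rw [heq, hnorm] at hdev
  linarith

end Halfspace

/-! ### Reduction of robust margins to homogeneous halfspaces -/

section RobustMargin

variable {d n : ℕ} {ε b : ℝ}

/-- The extremal perturbation is x - yεw; Cauchy–Schwarz shows that none does worse. -/
lemma mem_robustMarginSet_iff (hε : 0 ≤ ε) {t : ℝ} {w : EuclideanSpace ℝ (Fin d)} (hw : ‖w‖ = 1)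
    {p : EuclideanSpace ℝ (Fin d) × ℝ} (hp : p.2 = 1 ∨ p.2 = -1) :
    p ∈ robustMarginSet ε t w ↔ p.2 * inner ℝ w p.1 - ε ≤ t := by
  constructor
  · rintro ⟨x', hx', h⟩
    rw [Metric.mem_closedBall, dist_eq_norm] at hx'
    have h1 := abs_real_inner_le_norm w (x' - p.1)
    rw [hw, one_mul, inner_sub_right] at h1
    have h2 := abs_le.1 (h1.trans hx')
    rcases hp with hp | hp <;> rw [hp] at h ⊢ <;> linarith [h2.1, h2.2]
  · intro h
    refine ⟨p.1 - (p.2 * ε) • w, ?_, ?_⟩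
    · rw [Metric.mem_closedBall, dist_eq_norm]
      have h1 : |p.2| = 1 := by rcases hp with hp | hp <;> simp [hp]
      simp [norm_smul, hw, h1, abs_of_nonneg hε]
    · rw [inner_sub_right, real_inner_smul_right, real_inner_self_eq_norm_sq, hw]
      rcases hp with hp | hp <;> rw [hp] at h ⊢ <;> linarith

/-- The feature vector that turns affine classifiers into homogeneous ones. -/
noncomputable def liftedFeature (b : ℝ) (p : EuclideanSpace ℝ (Fin d) × ℝ) :
    WithLp 2 (EuclideanSpace ℝ (Fin d) × ℝ) :=
  WithLp.toLp 2 (p.2 • p.1, -b)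

lemma measurable_liftedFeature : Measurable (liftedFeature (d := d) b) := by
  unfold liftedFeature
  fun_prop

lemma norm_liftedFeature_le {p : EuclideanSpace ℝ (Fin d) × ℝ} (hp : p.2 = 1 ∨ p.2 = -1)
    (hb : ‖p.1‖ ≤ b) : ‖liftedFeature b p‖ ≤ √2 * b := by
  have hb0 : 0 ≤ b := (norm_nonneg _).trans hb
  rw [liftedFeature, WithLp.prod_norm_eq_of_L2]
  refine Real.sqrt_le_left (by positivity) |>.2 ?_
  have h1 : |p.2| = 1 := by rcases hp with hp | hp <;> simp [hp]
  have h2 : ‖p.1‖ ^ 2 ≤ b ^ 2 := by gcongr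
  simp only [WithLp.toLp_fst, WithLp.toLp_snd, norm_smul, Real.norm_eq_abs, h1, one_mul, abs_neg,
    sq_abs, mul_pow]
  rw [Real.sq_sqrt (by norm_num)]
  linarith

lemma inner_liftedFeature (hb : b ≠ 0) (w : EuclideanSpace ℝ (Fin d)) (a : ℝ)
    (p : EuclideanSpace ℝ (Fin d) × ℝ) :
    inner ℝ (WithLp.toLp 2 (w, a / b)) (liftedFeature b p) = p.2 * inner ℝ w p.1 - a := by
  rw [liftedFeature, WithLp.prod_inner_apply]
  simp only [real_inner_smul_right]
  simp
  field_simp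
  ring

/-- The offset `a` is later ε + γ, so that margins 0 and 2γ become the symmetric levels -γ and γ. -/
lemma robustMarginLoss_eq_indicator (hε : 0 ≤ ε) (hb : b ≠ 0) {t a s : ℝ} (hts : t = a - ε + s)
    {w : EuclideanSpace ℝ (Fin d)} (hw : ‖w‖ = 1) {p : EuclideanSpace ℝ (Fin d) × ℝ}
    (hp : p.2 = 1 ∨ p.2 = -1) :
    robustMarginLoss ε t w p = {z | inner ℝ (WithLp.toLp 2 (w, a / b)) z ≤ s}.indicator 1
      (liftedFeature b p) := by
  have h1 := mem_robustMarginSet_iff hε (t := t) hw hp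
  have h2 : liftedFeature b p ∈ {z | inner ℝ (WithLp.toLp 2 (w, a / b)) z ≤ s} ↔
      p.2 * inner ℝ w p.1 - a ≤ s := by
    rw [Set.mem_ofPred_eq, inner_liftedFeature hb]
  rw [robustMarginLoss]
  by_cases h : p.2 * inner ℝ w p.1 - ε ≤ t
  · rw [Set.indicator_of_mem (h1.2 h), Set.indicator_of_mem (h2.2 (by linarith)), Pi.one_apply]
  · rw [Set.indicator_of_notMem (mt h1.1 h),
      Set.indicator_of_notMem (mt h2.1 fun h' => h (by linarith))]

lemma robustError_le_one (D : Measure (EuclideanSpace ℝ (Fin d) × ℝ)) [IsProbabilityMeasure D]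
    (w : EuclideanSpace ℝ (Fin d)) : robustError D ε w ≤ 1 := by
  calc robustError D ε w ≤ ∫ _, (1 : ℝ) ∂D := by
        refine integral_mono_of_nonneg
          (ae_of_all _ fun p => Set.indicator_nonneg (fun _ _ => zero_le_one) p)
          (integrable_const _) (ae_of_all _ fun p => ?_)
        exact Set.indicator_le_self' (fun _ _ => zero_le_one) p
    _ = 1 := by simp

/-- No margin exceeds `b`, so no robust margin exceeds `b - ε`. This is the trivial regime of the
bound. -/
lemma empiricalMarginError_eq_one (hε : 0 ≤ ε) (hn : 0 < n) {t : ℝ} (hbt : b ≤ ε + t)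
    {w : EuclideanSpace ℝ (Fin d)} (hw : ‖w‖ = 1) {S : Fin n → EuclideanSpace ℝ (Fin d) × ℝ}
    (hS : ∀ i, ((S i).2 = 1 ∨ (S i).2 = -1) ∧ ‖(S i).1‖ ≤ b) :
    empiricalMarginError S ε t w = 1 := by
  have h : ∀ i, robustMarginLoss ε t w (S i) = 1 := fun i => by
    refine Set.indicator_of_mem ((mem_robustMarginSet_iff hε hw (hS i).1).2 ?_) _
    have h1 := abs_real_inner_le_norm w (S i).1
    rw [hw, one_mul] at h1
    have h2 := abs_le.1 (h1.trans (hS i).2)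
    rcases (hS i).1 with hp | hp <;> rw [hp] <;> linarith [h2.1, h2.2]
  have hn' : (n : ℝ) ≠ 0 := by positivity
  simp [empiricalMarginError, h, hn']

/-- The confidence term of the Gaussian comparison with `exp (-log n)` tails is at most the
confidence term of the margin bound. -/
lemma confidence_term_le {N K M L : ℝ} (hN : 2 ≤ N) (hK : Real.log 2 ≤ K) (hL : 0 ≤ L)
    (hM : M ≤ Real.log 2 + L + 8 * K) :
    2 / N + √(M / N) ≤ √(24 / N * (K + L)) := by
  have hlog : 2 / 3 < Real.log 2 := by linarith [Real.log_two_gt_d9]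
  have hN0 : 0 < N := by linarith
  refine Real.le_sqrt_of_sq_le ?_
  -- The term log 2 is absorbed into `K`. Then (x + y)² ≤ 2x² + 2y² gives 2 · 3 + 2 · 9 = 24.
  have h0 : √(M / N) ≤ √((9 * K + L) / N) :=
    Real.sqrt_le_sqrt (div_le_div_of_nonneg_right (by linarith) hN0.le)
  have h1 : √((9 * K + L) / N) ^ 2 = (9 * K + L) / N :=
    Real.sq_sqrt (div_nonneg (by linarith) hN0.le)
  have h2 : (2 / N) ^ 2 ≤ 3 * K / N := by
    rw [div_pow, div_le_div_iff₀ (by positivity) hN0]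
    have h3 : 4 ≤ 3 * K * N := by nlinarith
    nlinarith
  have h3 : (2 / N + √(M / N)) ^ 2 ≤ (2 / N + √((9 * K + L) / N)) ^ 2 := by
    gcongr
  have h4 : (2 / N + √((9 * K + L) / N)) ^ 2 ≤ 2 * (3 * K / N) + 2 * ((9 * K + L) / N) := by
    nlinarith [sq_nonneg (2 / N - √((9 * K + L) / N))]
  have h5 : 2 * (3 * K / N) + 2 * ((9 * K + L) / N) = 24 / N * (K + L) - 22 * L / N := by
    field_simp
    ring
  have h6 : 0 ≤ 22 * L / N := by positivity
  linarith

/-- The robust margin bound holds on every sample whose exponential moment of deviations is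
controlled. -/
lemma robustError_le_empiricalMarginError_add (hε : 0 ≤ ε)
    {D : Measure (EuclideanSpace ℝ (Fin d) × ℝ)} [IsProbabilityMeasure D]
    (hD : ∀ᵐ p ∂D, (p.2 = 1 ∨ p.2 = -1) ∧ ‖p.1‖ ≤ b) (hn : 2 ≤ n) {δ : ℝ} (hδ : 0 < δ)
    (hδ1 : δ < 1) {S : Fin n → EuclideanSpace ℝ (Fin d) × ℝ}
    (hSb : ∀ i, ((S i).2 = 1 ∨ (S i).2 = -1) ∧ ‖(S i).1‖ ≤ b)
    (hS : ∫⁻ v, ENNReal.ofReal (Real.exp (n * halfspaceDeviation D (liftedFeature b) S v ^ 2))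
      ∂(stdGaussian (WithLp 2 (EuclideanSpace ℝ (Fin d) × ℝ))) ≤ ENNReal.ofReal (2 / δ))
    {γ : ℝ} (hγ : 0 < γ) {w : EuclideanSpace ℝ (Fin d)} (hw : ‖w‖ = 1) :
    robustError D ε w ≤ empiricalMarginError S ε (2 * γ) w +
      √(24 / n * (b ^ 2 / γ ^ 2 * Real.log n + Real.log (1 / δ))) := by
  have hn0 : 0 < n := by omega
  have hn2 : (2 : ℝ) ≤ n := by exact_mod_cast hn
  -- Outside the trivial case, ε + γ and γ are both below `b`, which bounds the lifted weight and
  -- gives b²/γ² ≥ 1.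
  rcases le_or_gt b (ε + 2 * γ) with hb | hb
  · rw [empiricalMarginError_eq_one hε hn0 hb hw hSb]
    exact (robustError_le_one D w).trans (le_add_of_nonneg_right (Real.sqrt_nonneg _))
  have hb0 : 0 < b := by linarith
  have hlogn : Real.log 2 ≤ Real.log n := Real.log_le_log (by norm_num) hn2
  have hlog2 : 0 < Real.log 2 := Real.log_pos (by norm_num)
  -- Chosen so that the Gaussian tail, for features of norm at most √2 b, is exactly 1/n.
  set s : ℝ := 2 * b / γ * √(Real.log n) with hs
  have hs0 : 0 ≤ s := by positivity
  have hssq : s ^ 2 = 4 * (b ^ 2 / γ ^ 2 * Real.log n) := by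
    rw [hs, mul_pow, Real.sq_sqrt (by linarith)]
    ring
  rw [← Real.exp_log (show 0 < 2 / δ by positivity)] at hS
  have h := measureReal_inner_le_neg_margin_le measurable_liftedFeature hn0
    (B := √2 * b) (by positivity) (hD.mono fun p hp => norm_liftedFeature_le hp.1 hp.2)
    (fun i => norm_liftedFeature_le (hSb i).1 (hSb i).2) hS (WithLp.toLp 2 (w, (ε + γ) / b))
    hγ.le hs0
  have h1 : robustError D ε w = ∫ p, {z | inner ℝ (WithLp.toLp 2 (w, (ε + γ) / b)) z
      ≤ -γ}.indicator 1 (liftedFeature b p) ∂D :=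
    integral_congr_ae (hD.mono fun p hp =>
      robustMarginLoss_eq_indicator hε hb0.ne' (by ring) hw hp.1)
  have h2 : empiricalMarginError S ε (2 * γ) w = (1 / (n : ℝ)) * ∑ i,
      {z | inner ℝ (WithLp.toLp 2 (w, (ε + γ) / b)) z ≤ γ}.indicator 1 (liftedFeature b (S i)) := by
    rw [empiricalMarginError]
    congr 1
    exact Finset.sum_congr rfl fun i _ =>
      robustMarginLoss_eq_indicator hε hb0.ne' (by ring) hw (hSb i).1
  rw [← h1, ← h2] at h
  have h3 : Real.exp (-((s * γ) ^ 2 / (2 * (√2 * b) ^ 2))) = 1 / n := by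
    have h4 : (s * γ) ^ 2 / (2 * (√2 * b) ^ 2) = Real.log n := by
      rw [mul_pow, hssq, mul_pow, Real.sq_sqrt (by norm_num)]
      field_simp
      ring
    rw [h4, Real.exp_neg, Real.exp_log (by linarith), one_div]
  -- Scaling the extra feature by `b` keeps the offset coordinate at most 1; hence the divergence is
  -- at most 2s² = 8(b²/γ²) ln n.
  have h5 : ‖(WithLp.toLp 2 (w, (ε + γ) / b) : WithLp 2 (EuclideanSpace ℝ (Fin d) × ℝ))‖ ^ 2
      ≤ 2 := by
    rw [WithLp.prod_norm_sq_eq_of_L2]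
    simp only [WithLp.toLp_fst, WithLp.toLp_snd, hw, Real.norm_eq_abs, sq_abs]
    have h6 : (ε + γ) / b ≤ 1 := (div_le_one hb0).2 (by linarith)
    have h7 : 0 ≤ (ε + γ) / b := by positivity
    nlinarith
  have hbγ : 1 ≤ b ^ 2 / γ ^ 2 := by
    rw [one_le_div (by positivity)]
    gcongr
    linarith
  rw [h3] at h
  refine h.trans ?_
  rw [add_assoc]
  refine add_le_add_right ?_ _
  rw [mul_one_div]
  refine confidence_term_le hn2 (by nlinarith)
    (Real.log_nonneg (by rw [le_div_iff₀ hδ]; linarith)) ?_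
  rw [mul_pow, hssq, show 2 / δ = 2 * (1 / δ) by ring, Real.log_mul (by norm_num) (by positivity)]
  have h8 : 0 ≤ b ^ 2 / γ ^ 2 * Real.log n := by positivity
  nlinarith

end RobustMargin

theorem theorem4 :
    ∃ C : ℝ, 0 < C ∧
      ∀ (d : ℕ) (b ε : ℝ), 0 ≤ ε →
      ∀ (D : Measure (EuclideanSpace ℝ (Fin d) × ℝ)), IsProbabilityMeasure D →
        (∀ᵐ p ∂D, p.2 = 1 ∨ p.2 = -1) →
        (∀ᵐ p ∂D, ‖p.1‖ ≤ b) →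
      ∀ (n : ℕ), 2 ≤ n →
      ∀ (δ : ℝ), 0 < δ → δ < 1 →
        -- the failure event has (outer) probability at most `δ` over `n` i.i.d. samples
        Measure.pi (fun _ : Fin n => D)
          {S | ¬ ∀ (γ : ℝ), 0 < γ → ∀ (w : EuclideanSpace ℝ (Fin d)), ‖w‖ = 1 →
            robustError D ε w ≤ empiricalMarginError S ε (2 * γ) w +
              Real.sqrt (C / n * (b ^ 2 / γ ^ 2 * Real.log n + Real.log (1 / δ)))}
          ≤ ENNReal.ofReal δ := by
  refine ⟨24, by norm_num, ?_⟩
  intro d b ε hε D _ hy hx n hn δ hδ hδ1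
  have hD : ∀ᵐ p ∂D, (p.2 = 1 ∨ p.2 = -1) ∧ ‖p.1‖ ≤ b := hy.and hx
  have hSb : ∀ᵐ S ∂(Measure.pi fun _ : Fin n => D),
      ∀ i, ((S i).2 = 1 ∨ (S i).2 = -1) ∧ ‖(S i).1‖ ≤ b :=
    ae_all_iff.2 fun i =>
      (measurePreserving_eval (fun _ : Fin n => D) i).quasiMeasurePreserving.ae hD
  -- Almost-everywhere inclusion in the Markov event suffices, so the failure set need not be
  -- measurable.
  refine le_trans (measure_mono_ae ?_) (measure_le_lintegral_exp_halfspaceDeviation_sq_le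
    (measurable_liftedFeature (b := b)) (by omega : 0 < n) hδ)
  filter_upwards [hSb] with S hSb' hbad
  by_contra hS
  exact hbad fun γ hγ w hw => robustError_le_empiricalMarginError_add hε hD hn hδ hδ1 hSb'
    (not_le.1 hS).le hγ hw
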